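/- Let $X=\{X_s : s\ge 0\}$ be the continuous-time symmetric simple random walk on $\mathbb Z$ with jump rates $\lambda(x,y)=1/2$ if $|x-y|=1$ and $\lambda(x,y)=0$ otherwise, i.e. the càdlàg Markov process on $\mathbb Z$ with generator $Lf(x)=\tfrac12[f(x+1)-f(x)]+\tfrac12[f(x-1)-f(x)]$. Let $\mathbb E_x$ denote expectation for the walk started from $x\in\mathbb Z$, and let $\xi(y,s)=\int_0^s \mathbf 1_{\{X_r=y\}}\,dr$ be the local time at $y\in\mathbb Z$ up to time $s$. Then for every $t\ge 0$ there is a constant $C=C(t)>0$ such that, for every $x\in\mathbb Z$ and every integer $n\ge 1$, \[ \mathbb E_x\Big[\Big(\frac{\xi(0,tn^2)}{n}-\frac{\xi(-1,tn^2)}{n}\Big)^2\Big]\le \frac{C}{n} \qquad\text{and}\qquad \mathbb E_x\Big[\Big|\frac{\xi(0,tn^2)}{n}-\frac{\xi(-1,tn^2)}{n}\Big|\Big]\le \frac{C}{\sqrt n}. \] -/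

import Mathlib

open MeasureTheory ProbabilityTheory Filter Topology
open scoped NNReal

noncomputable section

namespace SimpleRandomWalk

/-- The generator of the continuous-time symmetric simple random walk on `ℤ`, with jump rate `1/2`
from each site to each of its two neighbours. -/
def generator (f : ℤ → ℝ) (x : ℤ) : ℝ :=
  1 / 2 * (f (x + 1) - f x) + 1 / 2 * (f (x - 1) - f x)

/-- The Markov semigroup `e^{tL} f = ∑ₖ tᵏ/k! Lᵏ f` with generator `L`. It is used for bounded `f`,
where `|Lᵏ f| ≤ 2ᵏ sup |f|`, so that the series converges absolutely. -/
def semigroup (t : ℝ≥0) (f : ℤ → ℝ) (x : ℤ) : ℝ :=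
  ∑' k : ℕ, (t : ℝ) ^ k / (k.factorial : ℝ) * (generator^[k] f) x

variable {Ω : Type*} [MeasurableSpace Ω]

/-- The information `σ(X_r : r ≤ s)` generated by the process up to time `s`. -/
@[reducible]
def history (X : ℝ≥0 → Ω → ℤ) (s : ℝ≥0) : MeasurableSpace Ω :=
  ⨆ r : Set.Iic s, MeasurableSpace.comap (X r) ⊤

/-- Under `P`, the process `X` is a continuous-time symmetric simple random walk on `ℤ` started
from `x`: a càdlàg Markov process with semigroup `e^{tL}`. -/
structure IsWalk (X : ℝ≥0 → Ω → ℤ) (P : Measure Ω) (x : ℤ) : Prop where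
  isProbabilityMeasure : IsProbabilityMeasure P
  measurable : ∀ t, Measurable (X t)
  rightContinuous : ∀ ω t, ContinuousWithinAt (fun s => X s ω) (Set.Ici t) t
  leftLimit : ∀ ω t, ∃ y : ℤ, Tendsto (fun s => X s ω) (𝓝[<] t) (𝓝 y)
  start : ∀ᵐ ω ∂P, X 0 ω = x
  markov : ∀ (s t : ℝ≥0) (f : ℤ → ℝ), (∃ M : ℝ, ∀ y, |f y| ≤ M) →
    P[fun ω => f (X (s + t) ω) | history X s] =ᵐ[P] fun ω => semigroup t f (X s ω)

/-- The local time `ξ(y, t) = ∫₀ᵗ 𝟙_{y}(X_s) ds` of the process `X` at the site `y`. -/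
def localTime (X : ℝ≥0 → Ω → ℤ) (y : ℤ) (t : ℝ≥0) (ω : Ω) : ℝ :=
  ∫ s in (0 : ℝ)..t, Set.indicator {y} (fun _ => (1 : ℝ)) (X s.toNNReal ω)

end SimpleRandomWalk

end

noncomputable section

namespace SimpleRandomWalk

/-! The difference of the indicators of `0` and `-1` equals `L h` for the bounded step function `h =
-2 · 𝟙_{z ≥ 0}` (`generator_step`), so the difference of local times is the additive functional `∫₀ᵀ
L h (X_s) ds`.

Its second moment is twice the integral of `E[L h (X_s) L h (X_r)]` over `s < r`. By the Markov
property and Kolmogorov's equation, integrating over `r` leaves `E[L h (X_s) (e^{(T-s)L} h -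
h)(X_s)]`, and the last factor is at most `2 sup |h|` whatever `T` is. This cancellation is the main
point: it bounds the second moment by a multiple of the expected time spent at `0` and `-1`
(`integral_sq_additiveFunctional_le`).

That expected time is of order `√T`, uniformly in the starting point. Instead of heat kernel
asymptotics, an approximate solution of Poisson's equation is used
(`integral_semigroup_indicator_le`). With `T = t n²` the second moment is `O(n)`, hence `O(1/n)`
after division by `n²`. The first moment follows by the inequality of arithmetic and geometric
means. -/

/-- The Banach space of bounded functions on `ℤ` with the supremum norm. -/
def BoundedFunction : Type := BoundedContinuousFunction ℤ ℝ

/-! ### Bounded functions on `ℤ` -/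

namespace BoundedFunction

instance : NormedAddCommGroup BoundedFunction :=
  inferInstanceAs (NormedAddCommGroup (BoundedContinuousFunction ℤ ℝ))

instance : NormedSpace ℝ BoundedFunction :=
  inferInstanceAs (NormedSpace ℝ (BoundedContinuousFunction ℤ ℝ))

instance : CompleteSpace BoundedFunction :=
  inferInstanceAs (CompleteSpace (BoundedContinuousFunction ℤ ℝ))

instance : FunLike BoundedFunction ℤ ℝ :=
  inferInstanceAs (FunLike (BoundedContinuousFunction ℤ ℝ) ℤ ℝ)

/-- A function bounded by `M` as an element of the space of bounded functions. -/
def of (f : ℤ → ℝ) (M : ℝ) (hf : ∀ y, |f y| ≤ M) : BoundedFunction :=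
  BoundedContinuousFunction.ofNormedAddCommGroupDiscrete f M hf

@[simp] lemma coe_of (f : ℤ → ℝ) (M : ℝ) (hf : ∀ y, |f y| ≤ M) : ⇑(of f M hf) = f := rfl

/-- Makes the identity operator have norm one, as `norm_exp_le_exp_norm` requires of the operator
algebra. -/
instance : Nontrivial BoundedFunction :=
  ⟨of 0 0 (by simp), of 1 1 (by simp), fun h => by simpa using DFunLike.congr_fun h 0⟩

@[simp] lemma add_apply (f g : BoundedFunction) (x : ℤ) : (f + g) x = f x + g x := rfl

@[simp] lemma smul_apply (c : ℝ) (f : BoundedFunction) (x : ℤ) : (c • f) x = c * f x := rfl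

lemma abs_apply_le_norm (f : BoundedFunction) (x : ℤ) : |f x| ≤ ‖f‖ :=
  BoundedContinuousFunction.norm_coe_le_norm (α := ℤ) (β := ℝ) f x

lemma norm_le {f : BoundedFunction} {M : ℝ} (hM : 0 ≤ M) (hf : ∀ x, |f x| ≤ M) : ‖f‖ ≤ M :=
  (BoundedContinuousFunction.norm_le (α := ℤ) (β := ℝ) (f := f) hM).2 hf

/-- Evaluation at a point as a continuous linear functional. -/
def eval (x : ℤ) : BoundedFunction →L[ℝ] ℝ :=
  LinearMap.mkContinuous
    { toFun := fun f => f x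
      map_add' := fun _ _ => rfl
      map_smul' := fun _ _ => rfl }
    1 fun f => by rw [one_mul]; exact f.abs_apply_le_norm x

@[simp] lemma eval_apply (x : ℤ) (f : BoundedFunction) : eval x f = f x := rfl

end BoundedFunction

/-! ### The semigroup as an operator exponential -/

lemma abs_average_le (f : BoundedFunction) (x : ℤ) :
    |1 / 2 * f (x + 1) + 1 / 2 * f (x - 1)| ≤ ‖f‖ := by
  have h₁ := abs_le.1 (f.abs_apply_le_norm (x + 1))
  have h₂ := abs_le.1 (f.abs_apply_le_norm (x - 1))
  rw [abs_le]
  constructor <;> linarith [h₁.1, h₁.2, h₂.1, h₂.2]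

/-- The one-step averaging operator `Q f x = (f (x + 1) + f (x - 1)) / 2` on bounded functions. -/
def averagingCLM : BoundedFunction →L[ℝ] BoundedFunction :=
  LinearMap.mkContinuous
    { toFun := fun f => BoundedFunction.of
        (fun x => 1 / 2 * f (x + 1) + 1 / 2 * f (x - 1)) ‖f‖ (abs_average_le f)
      map_add' := fun f g => DFunLike.ext _ _ fun x => by
        simp only [BoundedFunction.coe_of, BoundedFunction.add_apply]
        ring
      map_smul' := fun c f => DFunLike.ext _ _ fun x => by
        simp only [BoundedFunction.coe_of, BoundedFunction.smul_apply, RingHom.id_apply]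
        ring }
    1 fun f => (BoundedFunction.norm_le (norm_nonneg f) (abs_average_le f)).trans_eq
      (one_mul ‖f‖).symm

lemma averagingCLM_apply (f : BoundedFunction) (x : ℤ) :
    averagingCLM f x = 1 / 2 * f (x + 1) + 1 / 2 * f (x - 1) := rfl

lemma norm_averagingCLM_le : ‖averagingCLM‖ ≤ 1 :=
  LinearMap.mkContinuous_norm_le _ zero_le_one _

/-- The generator as a bounded operator on bounded functions. -/
def generatorCLM : BoundedFunction →L[ℝ] BoundedFunction := averagingCLM - 1

lemma coe_generatorCLM (f : BoundedFunction) : ⇑(generatorCLM f) = generator f := by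
  ext x
  change averagingCLM f x - f x = generator f x
  rw [averagingCLM_apply, generator]
  ring

lemma coe_generatorCLM_pow (k : ℕ) (f : BoundedFunction) :
    ⇑((generatorCLM ^ k) f) = generator^[k] f := by
  induction k with
  | zero => rfl
  | succ k ih =>
    rw [Function.iterate_succ_apply', pow_succ', mul_apply_eq_comp, coe_generatorCLM, ih]

/-- The semigroup is the operator exponential of the generator. -/
lemma semigroup_eq_exp (t : ℝ≥0) (f : BoundedFunction) (x : ℤ) :
    semigroup t f x = NormedSpace.exp ((t : ℝ) • generatorCLM) f x := by
  have h := NormedSpace.exp_series_hasSum_exp' (𝕂 := ℝ) ((t : ℝ) • generatorCLM)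
  have h₁ := h.mapL ((BoundedFunction.eval x).comp
    (ContinuousLinearMap.apply ℝ BoundedFunction f))
  refine Eq.trans ?_ h₁.tsum_eq
  refine tsum_congr fun k => ?_
  rw [← coe_generatorCLM_pow]
  simp [smul_pow]
  ring

lemma norm_exp_le_exp_norm {A : Type*} [NormedRing A] [NormOneClass A] [NormedAlgebra ℝ A]
    [CompleteSpace A] (a : A) : ‖NormedSpace.exp a‖ ≤ Real.exp ‖a‖ := by
  have h := NormedSpace.exp_series_hasSum_exp' (𝕂 := ℝ) a
  have h₁ := NormedSpace.exp_series_hasSum_exp' (𝕂 := ℝ) ‖a‖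
  rw [← Real.exp_eq_exp_ℝ] at h₁
  rw [← h.tsum_eq]
  refine tsum_of_norm_bounded h₁ fun k => ?_
  rw [norm_smul, smul_eq_mul, norm_inv, RCLike.norm_natCast]
  gcongr
  exact norm_pow_le a k

/-- Since `L = Q - 1` with `‖Q‖ ≤ 1`, `e^{tL} = e^{-t} e^{tQ}` and `‖e^{tQ}‖ ≤ e^t`. Using only `‖L‖
≤ 2` would lose the contraction property. -/
lemma norm_exp_smul_generatorCLM_le {t : ℝ} (ht : 0 ≤ t) :
    ‖NormedSpace.exp (t • generatorCLM)‖ ≤ 1 := by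
  have h : t • generatorCLM =
      (-t) • (1 : BoundedFunction →L[ℝ] BoundedFunction) + t • averagingCLM := by
    rw [generatorCLM]; module
  have hc : Commute ((-t) • (1 : BoundedFunction →L[ℝ] BoundedFunction)) (t • averagingCLM) :=
    ((Commute.one_left _).smul_left _).smul_right _
  let : NormedAlgebra ℚ (BoundedFunction →L[ℝ] BoundedFunction) :=
    NormedAlgebra.restrictScalars ℚ ℝ _
  have h1 : NormedSpace.exp ((-t) • (1 : BoundedFunction →L[ℝ] BoundedFunction)) =
      Real.exp (-t) • 1 := by
    rw [← Algebra.algebraMap_eq_smul_one, ← NormedSpace.algebraMap_exp_comm,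
      ← Real.exp_eq_exp_ℝ, Algebra.algebraMap_eq_smul_one]
  rw [h, NormedSpace.exp_add_of_commute hc, h1, smul_mul_assoc, one_mul, norm_smul,
    Real.norm_eq_abs, abs_of_pos (Real.exp_pos _)]
  calc Real.exp (-t) * ‖NormedSpace.exp (t • averagingCLM)‖
      ≤ Real.exp (-t) * Real.exp t := by
        gcongr
        refine (norm_exp_le_exp_norm _).trans (Real.exp_le_exp.2 ?_)
        rw [norm_smul, Real.norm_eq_abs, abs_of_nonneg ht]
        exact mul_le_of_le_one_right ht norm_averagingCLM_le
    _ = 1 := by rw [← Real.exp_add]; simp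

/-- The semigroup is a contraction for the supremum norm. -/
lemma abs_semigroup_le {f : ℤ → ℝ} {M : ℝ} (hf : ∀ y, |f y| ≤ M) (t : ℝ≥0) (x : ℤ) :
    |semigroup t f x| ≤ M := by
  have hM : 0 ≤ M := (abs_nonneg _).trans (hf 0)
  let F : BoundedFunction := .of f M hf
  have hF : ‖F‖ ≤ M := BoundedFunction.norm_le hM hf
  change |semigroup t F x| ≤ M
  rw [semigroup_eq_exp]
  refine (BoundedFunction.abs_apply_le_norm _ x).trans ?_
  refine (ContinuousLinearMap.le_opNorm _ F).trans ?_
  exact (mul_le_of_le_one_left (norm_nonneg F)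
    (norm_exp_smul_generatorCLM_le t.2)).trans hF

lemma hasDerivAt_exp_smul_generatorCLM_apply (f : BoundedFunction) (x : ℤ) (t : ℝ) :
    HasDerivAt (fun u : ℝ => NormedSpace.exp (u • generatorCLM) f x)
      (NormedSpace.exp (t • generatorCLM) (generatorCLM f) x) t :=
  (((BoundedFunction.eval x).comp
    (ContinuousLinearMap.apply ℝ BoundedFunction f)).hasFDerivAt.comp_hasDerivAt t
      (hasDerivAt_exp_smul_const (𝕂 := ℝ) generatorCLM t))

lemma continuous_semigroup {f : ℤ → ℝ} {M : ℝ} (hf : ∀ y, |f y| ≤ M) (x : ℤ) :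
    Continuous fun u : ℝ≥0 => semigroup u f x := by
  let F : BoundedFunction := .of f M hf
  change Continuous fun u : ℝ≥0 => semigroup u F x
  simp only [semigroup_eq_exp]
  exact (continuous_iff_continuousAt.2 fun t =>
    (hasDerivAt_exp_smul_generatorCLM_apply F x t).continuousAt).comp NNReal.continuous_coe

lemma semigroup_const_mul (t : ℝ≥0) (c : ℝ) (f : ℤ → ℝ) (x : ℤ) :
    semigroup t (fun y => c * f y) x = c * semigroup t f x := by
  have h : ∀ k : ℕ, generator^[k] (fun y => c * f y) = fun y => c * generator^[k] f y := by
    intro k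
    induction k with
    | zero => rfl
    | succ k ih =>
      rw [Function.iterate_succ_apply', Function.iterate_succ_apply', ih]
      ext y
      simp only [generator]
      ring
  simp only [semigroup, h, ← tsum_mul_left]
  exact tsum_congr fun k => by ring

lemma semigroup_add {f g : ℤ → ℝ} {M N : ℝ} (hf : ∀ y, |f y| ≤ M) (hg : ∀ y, |g y| ≤ N)
    (t : ℝ≥0) (x : ℤ) :
    semigroup t (fun y => f y + g y) x = semigroup t f x + semigroup t g x := by
  let F : BoundedFunction := .of f M hf
  let G : BoundedFunction := .of g N hg
  change semigroup t ⇑(F + G) x = semigroup t F x + semigroup t G x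
  simp only [semigroup_eq_exp, map_add, BoundedFunction.add_apply]

/-- Kolmogorov's equation in integrated form: `∫₀ᵀ e^{uL} L f du = e^{TL} f - f`. -/
lemma integral_semigroup_generator {f : ℤ → ℝ} {M : ℝ} (hf : ∀ y, |f y| ≤ M) (T : ℝ≥0) (x : ℤ) :
    ∫ u in (0 : ℝ)..T, semigroup u.toNNReal (generator f) x = semigroup T f x - f x := by
  let F : BoundedFunction := .of f M hf
  have hF : generator f = generatorCLM F := (coe_generatorCLM F).symm
  have h0 : f x = NormedSpace.exp ((0 : ℝ) • generatorCLM) F x := by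
    rw [zero_smul, NormedSpace.exp_zero]; rfl
  rw [h0, show semigroup T f x = semigroup T F x from rfl, semigroup_eq_exp, hF]
  rw [← intervalIntegral.integral_eq_sub_of_hasDerivAt
    (fun u _ => hasDerivAt_exp_smul_generatorCLM_apply F x u)
    (Continuous.intervalIntegrable (continuous_iff_continuousAt.2 fun t =>
      (hasDerivAt_exp_smul_generatorCLM_apply (generatorCLM F) x t).continuousAt) _ _)]
  refine intervalIntegral.integral_congr fun u hu => ?_
  rw [Set.uIcc_of_le T.coe_nonneg] at hu
  simp only [semigroup_eq_exp, Real.coe_toNNReal u hu.1]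

lemma abs_generator_le {f : ℤ → ℝ} {M : ℝ} (hf : ∀ y, |f y| ≤ M) (y : ℤ) :
    |generator f y| ≤ 2 * M := by
  have h₀ := abs_le.1 (hf y)
  have h₁ := abs_le.1 (hf (y + 1))
  have h₂ := abs_le.1 (hf (y - 1))
  rw [generator, abs_le]
  constructor <;> linarith [h₀.1, h₁.1, h₂.1, h₀.2, h₁.2, h₂.2]

/-! ### Poisson's equation and the Green function -/

lemma abs_indicator_singleton_le (y z : ℤ) :
    |Set.indicator {y} (fun _ => (1 : ℝ)) z| ≤ 1 := by
  by_cases h : z = y <;> simp [h]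

lemma intervalIntegrable_semigroup {f : ℤ → ℝ} {M : ℝ} (hf : ∀ y, |f y| ≤ M) (x : ℤ) (a b : ℝ) :
    IntervalIntegrable (fun u : ℝ => semigroup u.toNNReal f x) volume a b :=
  ((continuous_semigroup hf x).comp continuous_real_toNNReal).intervalIntegrable a b

/-- The function `z ↦ -(1 - δ) ^ |z - y|` solves Poisson's equation for the indicator of `y` up to
an error of order `δ ^ 2`. -/
lemma abs_indicator_sub_generator_le (y : ℤ) {δ : ℝ} (hδ : 0 < δ) (hδ' : δ ≤ 1) (z : ℤ) :
    |δ * Set.indicator {y} (fun _ => (1 : ℝ)) z -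
      generator (fun z => -(1 - δ) ^ (z - y).natAbs) z| ≤ δ ^ 2 / 2 := by
  -- The error at distance `k + 1` from `y`, where it equals `(1 - δ) ^ k * (δ ^ 2 / 2)`; at `y`
  -- itself it vanishes.
  have key : ∀ k : ℕ, |(1 / 2) * ((1 - δ) ^ (k + 2) - (1 - δ) ^ (k + 1)) +
      1 / 2 * ((1 - δ) ^ k - (1 - δ) ^ (k + 1))| ≤ δ ^ 2 / 2 := by
    intro k
    have h : (1 / 2) * ((1 - δ) ^ (k + 2) - (1 - δ) ^ (k + 1)) +
      1 / 2 * ((1 - δ) ^ k - (1 - δ) ^ (k + 1)) = (1 - δ) ^ k * (δ ^ 2 / 2) := by ring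
    have h0 : 0 ≤ (1 - δ) ^ k := pow_nonneg (by linarith) k
    have h1 : (1 - δ) ^ k ≤ 1 := pow_le_one₀ (by linarith) (by linarith)
    rw [h, abs_of_nonneg (by positivity)]
    exact mul_le_of_le_one_left (by positivity) h1
  rcases lt_trichotomy z y with h | rfl | h
  · obtain ⟨k, hk⟩ : ∃ k : ℕ, z = y - (k + 1) := ⟨(y - z - 1).toNat, by omega⟩
    have e0 : (z - y).natAbs = k + 1 := by omega
    have e1 : (z + 1 - y).natAbs = k := by omega
    have e2 : (z - 1 - y).natAbs = k + 2 := by omega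
    refine le_of_eq_of_le ?_ (key k)
    rw [Set.indicator_of_notMem (by simpa using h.ne)]
    simp only [generator, e0, e1, e2]
    congr 1
    ring
  · have e1 : (z + 1 - z).natAbs = 1 := by omega
    have e2 : (z - 1 - z).natAbs = 1 := by omega
    rw [Set.indicator_of_mem (Set.mem_singleton z)]
    simp only [generator, e1, e2, sub_self, Int.natAbs_zero]
    refine le_of_eq_of_le ?_ (by positivity : (0 : ℝ) ≤ δ ^ 2 / 2)
    rw [abs_eq_zero]
    ring
  · obtain ⟨k, hk⟩ : ∃ k : ℕ, z = y + (k + 1) := ⟨(z - y - 1).toNat, by omega⟩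
    have e0 : (z - y).natAbs = k + 1 := by omega
    have e1 : (z + 1 - y).natAbs = k + 2 := by omega
    have e2 : (z - 1 - y).natAbs = k := by omega
    refine le_of_eq_of_le ?_ (key k)
    rw [Set.indicator_of_notMem (by simpa using h.ne')]
    simp only [generator, e0, e1, e2]
    congr 1
    ring

/-- A bound on the Green function `∫₀ᵀ e^{sL}(x, y) ds`; the optimal `δ` is of order `T ^ (-1/2)`. -/
lemma integral_semigroup_indicator_le (x y : ℤ) (T : ℝ≥0) {δ : ℝ} (hδ : 0 < δ) (hδ' : δ ≤ 1) :
    ∫ s in (0 : ℝ)..T, semigroup s.toNNReal (Set.indicator {y} fun _ => (1 : ℝ)) x ≤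
      2 / δ + T * δ / 2 := by
  set f : ℤ → ℝ := fun z => -(1 - δ) ^ (z - y).natAbs with hfdef
  have hf : ∀ z, |f z| ≤ 1 := fun z => by
    rw [hfdef, abs_neg, abs_of_nonneg (pow_nonneg (by linarith) _)]
    exact pow_le_one₀ (by linarith) (by linarith)
  set r : ℤ → ℝ := fun z => δ * Set.indicator {y} (fun _ => (1 : ℝ)) z - generator f z with hrdef
  have hr : ∀ z, |r z| ≤ δ ^ 2 / 2 := abs_indicator_sub_generator_le y hδ hδ'
  have hsum : ∀ s : ℝ, δ * semigroup s.toNNReal (Set.indicator {y} fun _ => (1 : ℝ)) x =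
      semigroup s.toNNReal (generator f) x + semigroup s.toNNReal r x := fun s => by
    rw [← semigroup_const_mul, ← semigroup_add (abs_generator_le hf) hr]
    congr 1
    ext z
    simp [hrdef]
  -- Integrating `δ 𝟙_y = L f + r` along the semigroup: the first term telescopes to at most `2`,
  -- the second is at most `T δ² / 2`.
  have hint : δ * ∫ s in (0 : ℝ)..T, semigroup s.toNNReal (Set.indicator {y} fun _ => (1 : ℝ)) x =
      (semigroup T f x - f x) + ∫ s in (0 : ℝ)..T, semigroup s.toNNReal r x := by
    rw [← intervalIntegral.integral_const_mul, ← integral_semigroup_generator hf,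
      ← intervalIntegral.integral_add (intervalIntegrable_semigroup (abs_generator_le hf) x _ _)
        (intervalIntegrable_semigroup hr x _ _)]
    exact intervalIntegral.integral_congr fun s _ => hsum s
  have h1 : ∫ s in (0 : ℝ)..T, semigroup s.toNNReal r x ≤ T * (δ ^ 2 / 2) := by
    refine (le_abs_self _).trans ?_
    have h := intervalIntegral.norm_integral_le_of_norm_le_const (a := 0) (b := (T : ℝ))
      (f := fun s => semigroup s.toNNReal r x) (C := δ ^ 2 / 2)
      fun s _ => abs_semigroup_le hr s.toNNReal x
    rw [sub_zero, abs_of_nonneg T.coe_nonneg] at h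
    rw [mul_comm]
    exact h
  have h2 := abs_le.1 (abs_semigroup_le hf T x)
  have h3 := abs_le.1 (hf x)
  refine le_of_mul_le_mul_left ?_ hδ
  have h4 : δ * (2 / δ + T * δ / 2) = 2 + T * (δ ^ 2 / 2) := by
    field_simp
  rw [hint, h4]
  linarith [h2.2, h3.1]

/-- The difference of the indicators of `0` and `-1` is the generator applied to a bounded
function. -/
lemma generator_step (z : ℤ) :
    generator (fun z => if 0 ≤ z then -2 else 0) z =
      Set.indicator {0} (fun _ => (1 : ℝ)) z - Set.indicator {-1} (fun _ => (1 : ℝ)) z := by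
  -- Only `-1` and `0` see the jump of size `-2` between them, each with rate `1/2` and with
  -- opposite signs.
  rcases lt_trichotomy z (-1) with h | rfl | h
  · have h1 : ¬ 0 ≤ z := by omega
    have h2 : ¬ 0 ≤ z + 1 := by omega
    have h3 : ¬ 0 ≤ z - 1 := by omega
    rw [Set.indicator_of_notMem (by simp; omega), Set.indicator_of_notMem (by simp; omega)]
    simp only [generator, h1, h2, h3, if_false]
    ring
  · simp [generator]
  · rcases (show 0 ≤ z by omega).eq_or_lt with rfl | h'
    · simp [generator]
    · have h1 : 0 ≤ z := by omega
      have h2 : 0 ≤ z + 1 := by omega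
      have h3 : 0 ≤ z - 1 := by omega
      rw [Set.indicator_of_notMem (by simp; omega), Set.indicator_of_notMem (by simp; omega)]
      simp only [generator, h1, h2, h3, if_true]
      ring

/-! ### Joint measurability of the paths -/

variable {Ω : Type*} [MeasurableSpace Ω]

/-- The times `(⌊s (k + 1)⌋ + 1) / (k + 1)` approximate `s` from the right. -/
lemma tendsto_floor_add_one_div (s : ℝ≥0) :
    Tendsto (fun k : ℕ => ((⌊s * (k + 1)⌋₊ : ℝ≥0) + 1) / (k + 1)) atTop (𝓝[≥] s) := by
  have hk : ∀ k : ℕ, (0 : ℝ≥0) < k + 1 := fun k => by positivity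
  have hle : ∀ k : ℕ, s ≤ ((⌊s * (k + 1)⌋₊ : ℝ≥0) + 1) / (k + 1) := fun k =>
    (le_div_iff₀ (hk k)).2 (Nat.lt_floor_add_one (s * (k + 1))).le
  have hub : ∀ k : ℕ, ((⌊s * (k + 1)⌋₊ : ℝ≥0) + 1) / (k + 1) ≤ s + 1 / (k + 1) := fun k => by
    rw [div_le_iff₀ (hk k), add_mul, one_div, inv_mul_cancel₀ (hk k).ne']
    exact add_le_add_left (Nat.floor_le zero_le) 1
  refine tendsto_nhdsWithin_iff.2 ⟨?_, Eventually.of_forall hle⟩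
  refine tendsto_of_tendsto_of_tendsto_of_le_of_le tendsto_const_nhds ?_ hle hub
  have h := (tendsto_one_div_add_atTop_nhds_zero_nat (𝕜 := ℝ≥0)).const_add s
  simpa using h

/-- Only countably many times are visited, so measurability at each fixed time suffices. -/
lemma measurable_comp_discrete {X : ℝ≥0 → Ω → ℤ} (hX : ∀ t, Measurable (X t)) {N : ℝ≥0 → ℕ}
    (hN : Measurable N) {e : ℕ → ℝ≥0} : Measurable fun p : ℝ≥0 × Ω => X (e (N p.1)) p.2 := by
  have h : Measurable fun q : ℕ × Ω => X (e q.1) q.2 :=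
    measurable_from_prod_countable_right fun m => hX (e m)
  exact h.comp ((hN.comp measurable_fst).prodMk measurable_snd)

/-- A process with right-continuous paths in `ℤ` is jointly measurable. -/
lemma measurable_uncurry_of_rightContinuous {X : ℝ≥0 → Ω → ℤ} (hX : ∀ t, Measurable (X t))
    (hrc : ∀ ω t, ContinuousWithinAt (fun s => X s ω) (Set.Ici t) t) :
    Measurable fun p : ℝ≥0 × Ω => X p.1 p.2 := by
  refine measurable_of_tendsto_metrizable
    (f := fun (k : ℕ) (p : ℝ≥0 × Ω) => X (((⌊p.1 * (k + 1)⌋₊ : ℝ≥0) + 1) / (k + 1)) p.2)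
    (fun k => ?_) (tendsto_pi_nhds.2 fun p =>
      (hrc p.2 p.1).tendsto.comp (tendsto_floor_add_one_div p.1))
  exact measurable_comp_discrete hX (e := fun m : ℕ => ((m : ℝ≥0) + 1) / (k + 1))
    (Nat.measurable_floor.comp (measurable_id.mul_const ((k : ℝ≥0) + 1)))

/-! ### The Markov property under the expectation -/

namespace IsWalk

variable {X : ℝ≥0 → Ω → ℤ} {P : Measure Ω} {x : ℤ}

lemma measurable_uncurry (hX : IsWalk X P x) :
    Measurable fun p : ℝ × Ω => X p.1.toNNReal p.2 :=
  (measurable_uncurry_of_rightContinuous hX.measurable hX.rightContinuous).comp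
    ((measurable_real_toNNReal.comp measurable_fst).prodMk measurable_snd)

lemma history_le (hX : IsWalk X P x) (s : ℝ≥0) :
    history X s ≤ (inferInstance : MeasurableSpace Ω) :=
  iSup_le fun r => (hX.measurable r).comap_le

lemma measurable_history {Ω : Type*} (X : ℝ≥0 → Ω → ℤ) (s : ℝ≥0) :
    Measurable[history X s] (X s) := by
  refine Measurable.mono (comap_measurable (X s)) ?_ le_rfl
  exact le_iSup (fun r : Set.Iic s => MeasurableSpace.comap (X r) ⊤) ⟨s, Set.self_mem_Iic⟩

lemma integrable_comp (hX : IsWalk X P x) {f : ℤ → ℝ} {M : ℝ} (hf : ∀ y, |f y| ≤ M) (s : ℝ≥0) :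
    Integrable (fun ω => f (X s ω)) P := by
  have := hX.isProbabilityMeasure
  exact Integrable.of_bound ((measurable_from_top.comp (hX.measurable s)).aestronglyMeasurable) M
    (ae_of_all _ fun ω => hf _)

/-- The Markov property, tested against a bounded function of the present. -/
lemma integral_mul_comp_add (hX : IsWalk X P x) {f g : ℤ → ℝ} {M N : ℝ} (hf : ∀ y, |f y| ≤ M)
    (hg : ∀ y, |g y| ≤ N) (s u : ℝ≥0) :
    ∫ ω, g (X s ω) * f (X (s + u) ω) ∂P = ∫ ω, g (X s ω) * semigroup u f (X s ω) ∂P := by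
  have := hX.isProbabilityMeasure
  have hm := hX.history_le s
  have hgm : StronglyMeasurable[history X s] fun ω => g (X s ω) :=
    ((measurable_from_top (f := g)).comp (measurable_history X s)).stronglyMeasurable
  rw [← integral_condExp hm]
  refine integral_congr_ae ?_
  have h := condExp_stronglyMeasurable_mul_of_bound (μ := P) hm hgm
    (hX.integrable_comp hf (s + u)) N (ae_of_all _ fun ω => hg _)
  filter_upwards [h, hX.markov s u f ⟨M, hf⟩] with ω h1 h2
  rw [← h2]
  exact h1

/-- The Markov property at time `0`, where the walk is almost surely at `x`. -/
lemma integral_comp (hX : IsWalk X P x) {f : ℤ → ℝ} {M : ℝ} (hf : ∀ y, |f y| ≤ M) (t : ℝ≥0) :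
    ∫ ω, f (X t ω) ∂P = semigroup t f x := by
  have := hX.isProbabilityMeasure
  have h := hX.integral_mul_comp_add hf (g := fun _ => 1) (N := 1) (by simp) 0 t
  simp only [one_mul, zero_add] at h
  rw [h]
  have h' : (fun ω => semigroup t f (X 0 ω)) =ᵐ[P] fun _ => semigroup t f x := by
    filter_upwards [hX.start] with ω hω
    rw [hω]
  rw [integral_congr_ae h']
  simp

end IsWalk

/-! ### Second moments of additive functionals -/

/-- The integral of a symmetric kernel over a square is twice the integral over a triangle. -/
lemma integral_integral_eq_two_mul_of_symm {K : ℝ → ℝ → ℝ} {C T : ℝ}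
    (hm : Measurable fun p : ℝ × ℝ => K p.1 p.2) (hC : ∀ s r, |K s r| ≤ C)
    (hsymm : ∀ s r, K s r = K r s) :
    ∫ s in Set.Ioc 0 T, ∫ r in Set.Ioc 0 T, K s r =
      2 * ∫ s in Set.Ioc 0 T, ∫ r in s..T, K s r := by
  set ν : Measure ℝ := volume.restrict (Set.Ioc 0 T)
  let U : Set (ℝ × ℝ) := {p | p.1 < p.2}
  have hU : MeasurableSet U := measurableSet_lt measurable_fst measurable_snd
  have hK : Integrable (fun p : ℝ × ℝ => K p.1 p.2) (ν.prod ν) :=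
    Integrable.of_bound hm.aestronglyMeasurable C (ae_of_all _ fun p => hC _ _)
  have hKU : Integrable (U.indicator fun p : ℝ × ℝ => K p.1 p.2) (ν.prod ν) := hK.indicator hU
  have hKUc : Integrable (Uᶜ.indicator fun p : ℝ × ℝ => K p.1 p.2) (ν.prod ν) :=
    hK.indicator hU.compl
  have hsplit : ∀ p : ℝ × ℝ, K p.1 p.2 = U.indicator (fun p : ℝ × ℝ => K p.1 p.2) p +
      Uᶜ.indicator (fun p : ℝ × ℝ => K p.1 p.2) p := fun p =>
    (congrFun (Set.indicator_self_add_compl U fun p : ℝ × ℝ => K p.1 p.2) p).symm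
  have hupper : ∫ p, U.indicator (fun p : ℝ × ℝ => K p.1 p.2) p ∂ν.prod ν =
      ∫ s, (∫ r in s..T, K s r) ∂ν := by
    rw [integral_prod _ hKU]
    refine setIntegral_congr_fun measurableSet_Ioc fun s hs => ?_
    have h : (fun r => U.indicator (fun p : ℝ × ℝ => K p.1 p.2) (s, r)) =
        (Set.Ioi s).indicator fun r => K s r := by
      ext r
      by_cases h : s < r <;> simp [U, h]
    simp only [h]
    rw [integral_indicator measurableSet_Ioi, Measure.restrict_restrict measurableSet_Ioi,
      Set.inter_comm, Set.Ioc_inter_Ioi, sup_eq_right.2 hs.1.le,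
      intervalIntegral.integral_of_le hs.2]
  have hlower : ∫ p, Uᶜ.indicator (fun p : ℝ × ℝ => K p.1 p.2) p ∂ν.prod ν =
      ∫ s, (∫ r in s..T, K s r) ∂ν := by
    -- Swapping the coordinates turns `r ≤ s` into `s ≤ r`, and symmetry restores the kernel. The
    -- diagonal, which lies in `Uᶜ`, only adds an endpoint of measure zero.
    rw [← integral_prod_swap]
    refine (integral_prod _ hKUc.swap).trans ?_
    refine setIntegral_congr_fun measurableSet_Ioc fun s hs => ?_
    have h : (fun r => Uᶜ.indicator (fun p : ℝ × ℝ => K p.1 p.2) (s, r).swap) =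
        (Set.Ici s).indicator fun r => K s r := by
      ext r
      by_cases h : s ≤ r
      · simp [U, h, hsymm r s]
      · simp [U, h, not_le.1 h]
    simp only [Function.comp_apply, h]
    rw [integral_indicator measurableSet_Ici, Measure.restrict_restrict measurableSet_Ici,
      intervalIntegral.integral_of_le hs.2, ← integral_Icc_eq_integral_Ioc]
    congr 2
    ext r
    simp only [Set.mem_inter_iff, Set.mem_Ici, Set.mem_Ioc, Set.mem_Icc]
    exact ⟨fun h => ⟨h.1, h.2.2⟩, fun h => ⟨h.1, hs.1.trans_le h.1, h.2⟩⟩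
  rw [← integral_prod (fun p : ℝ × ℝ => K p.1 p.2) hK, integral_congr_ae (ae_of_all _ hsplit),
    integral_add hKU hKUc, hupper, hlower, two_mul]

namespace IsWalk

variable {X : ℝ≥0 → Ω → ℤ} {P : Measure Ω} {x : ℤ}

lemma measurable_comp_uncurry (hX : IsWalk X P x) (g : ℤ → ℝ) :
    Measurable fun p : ℝ × Ω => g (X p.1.toNNReal p.2) :=
  measurable_from_top.comp hX.measurable_uncurry

/-- The expected future integral of `L h`, weighted by a bounded function of the present. -/
lemma abs_integral_correlation_le (hX : IsWalk X P x) {g h : ℤ → ℝ} {M N : ℝ}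
    (hg : ∀ y, |g y| ≤ N) (hh : ∀ y, |h y| ≤ M) {s T : ℝ} (hs : 0 ≤ s) (hsT : s ≤ T) :
    |∫ r in s..T, ∫ ω, g (X s.toNNReal ω) * generator h (X r.toNNReal ω) ∂P| ≤
      2 * M * ∫ ω, |g (X s.toNNReal ω)| ∂P := by
  have := hX.isProbabilityMeasure
  have hLh := abs_generator_le hh
  have hM : 0 ≤ M := (abs_nonneg _).trans (hh 0)
  have hN : 0 ≤ N := (abs_nonneg _).trans (hg 0)
  set v : ℝ≥0 := (T - s).toNNReal with hv
  have hv' : (v : ℝ) = T - s := Real.coe_toNNReal _ (sub_nonneg.2 hsT)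
  have hmarkov : ∀ r ∈ Set.uIcc s T,
      ∫ ω, g (X s.toNNReal ω) * generator h (X r.toNNReal ω) ∂P =
        ∫ ω, g (X s.toNNReal ω) * semigroup (r - s).toNNReal (generator h) (X s.toNNReal ω) ∂P := by
    intro r hr
    rw [Set.uIcc_of_le hsT] at hr
    rw [← hX.integral_mul_comp_add hLh hg, ← Real.toNNReal_add hs (sub_nonneg.2 hr.1),
      add_sub_cancel]
  -- Continuity in time for each of the countably many sites gives the joint measurability needed
  -- for Fubini.
  have hmeas : Measurable fun p : ℝ × ℤ => semigroup p.1.toNNReal (generator h) p.2 :=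
    measurable_from_prod_countable_left fun z =>
      ((continuous_semigroup hLh z).comp continuous_real_toNNReal).measurable
  have hswap : ∫ u in (0 : ℝ)..v, ∫ ω, g (X s.toNNReal ω) *
        semigroup u.toNNReal (generator h) (X s.toNNReal ω) ∂P =
      ∫ ω, g (X s.toNNReal ω) * (semigroup v h (X s.toNNReal ω) - h (X s.toNNReal ω)) ∂P := by
    rw [intervalIntegral.integral_of_le v.coe_nonneg, integral_integral_swap]
    · refine integral_congr_ae (ae_of_all _ fun ω => ?_)
      simp only
      rw [integral_const_mul, ← integral_semigroup_generator hh,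
        intervalIntegral.integral_of_le v.coe_nonneg]
    · refine Integrable.of_bound (Measurable.aestronglyMeasurable ?_) (N * (2 * M))
        (ae_of_all _ fun p => ?_)
      · exact ((measurable_from_top (f := g)).comp ((hX.measurable _).comp measurable_snd)).mul
          (hmeas.comp (measurable_fst.prodMk ((hX.measurable s.toNNReal).comp measurable_snd)))
      · simp only [Function.uncurry, norm_mul, Real.norm_eq_abs]
        exact mul_le_mul (hg _) (abs_semigroup_le hLh _ _) (abs_nonneg _) hN
  rw [intervalIntegral.integral_congr hmarkov, intervalIntegral.integral_comp_sub_right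
    (fun u => ∫ ω, g (X s.toNNReal ω) *
      semigroup u.toNNReal (generator h) (X s.toNNReal ω) ∂P) s, sub_self, ← hv', hswap,
    ← integral_const_mul]
  rw [← Real.norm_eq_abs]
  refine norm_integral_le_of_norm_le (((hX.integrable_comp (f := fun y => |g y|) (M := N)
    (by simpa using hg) _).const_mul _)) (ae_of_all _ fun ω => ?_)
  rw [norm_mul, mul_comm, Real.norm_eq_abs, Real.norm_eq_abs]
  gcongr
  have h1 := abs_le.1 (abs_semigroup_le hh v (X s.toNNReal ω))
  have h2 := abs_le.1 (hh (X s.toNNReal ω))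
  rw [abs_le]
  constructor <;> linarith [h1.1, h1.2, h2.1, h2.2]

/-- The second moment of the additive functional `∫₀ᵀ L h (X_s) ds` is bounded by the expectation
of `∫₀ᵀ |L h (X_s)| ds`. -/
lemma integral_sq_additiveFunctional_le (hX : IsWalk X P x) {h : ℤ → ℝ} {M : ℝ}
    (hh : ∀ y, |h y| ≤ M) (T : ℝ≥0) :
    ∫ ω, (∫ s in (0 : ℝ)..T, generator h (X s.toNNReal ω)) ^ 2 ∂P ≤
      4 * M * ∫ s in (0 : ℝ)..T, semigroup s.toNNReal (fun y => |generator h y|) x := by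
  have := hX.isProbabilityMeasure
  have hLh := abs_generator_le hh
  have hM : 0 ≤ M := (abs_nonneg _).trans (hh 0)
  have habs : ∀ y, |(fun y => |generator h y|) y| ≤ 2 * M := by simpa using hLh
  set g := generator h with hgdef
  set ν : Measure ℝ := volume.restrict (Set.Ioc 0 (T : ℝ)) with hν
  let K : ℝ → ℝ → ℝ := fun s r => ∫ ω, g (X s.toNNReal ω) * g (X r.toNNReal ω) ∂P
  have hbound : ∀ a b : ℤ, |g a * g b| ≤ 2 * M * (2 * M) := fun a b => by
    rw [abs_mul]
    exact mul_le_mul (hLh a) (hLh b) (abs_nonneg _) (by positivity)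
  have hjoint : Measurable fun p : (ℝ × ℝ) × Ω =>
      g (X p.1.1.toNNReal p.2) * g (X p.1.2.toNNReal p.2) :=
    ((hX.measurable_comp_uncurry g).comp
      ((measurable_fst.comp measurable_fst).prodMk measurable_snd)).mul
    ((hX.measurable_comp_uncurry g).comp
      ((measurable_snd.comp measurable_fst).prodMk measurable_snd))
  have hKm : Measurable fun p : ℝ × ℝ => K p.1 p.2 :=
    (hjoint.stronglyMeasurable.integral_prod_right (ν := P)).measurable
  have hKb : ∀ s r, |K s r| ≤ 2 * M * (2 * M) := fun s r => by
    have h := norm_integral_le_of_norm_le_const (μ := P)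
      (f := fun ω => g (X s.toNNReal ω) * g (X r.toNNReal ω)) (C := 2 * M * (2 * M))
      (ae_of_all _ fun ω => hbound _ _)
    simpa using h
  have hKint : Integrable (fun p : ℝ × ℝ => K p.1 p.2) (ν.prod ν) :=
    Integrable.of_bound hKm.aestronglyMeasurable _ (ae_of_all _ fun p => hKb _ _)
  have hsq : ∫ ω, (∫ s in (0 : ℝ)..T, g (X s.toNNReal ω)) ^ 2 ∂P = ∫ s, ∫ r, K s r ∂ν ∂ν := by
    -- The square of a path integral is a double integral; Fubini then brings the expectation
    -- inside, onto the kernel `K`.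
    have hpath : ∀ ω, (∫ s in (0 : ℝ)..T, g (X s.toNNReal ω)) ^ 2 =
        ∫ p, g (X p.1.toNNReal ω) * g (X p.2.toNNReal ω) ∂ν.prod ν := fun ω => by
      rw [intervalIntegral.integral_of_le T.coe_nonneg, sq, ← hν]
      exact (integral_prod_mul (fun s : ℝ => g (X s.toNNReal ω))
        fun s : ℝ => g (X s.toNNReal ω)).symm
    simp only [hpath]
    rw [← integral_prod (fun p : ℝ × ℝ => K p.1 p.2) hKint, ← integral_integral_swap]
    exact Integrable.of_bound hjoint.aestronglyMeasurable _ (ae_of_all _ fun p => hbound _ _)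
  have hE : ∀ s : ℝ, ∫ ω, |g (X s.toNNReal ω)| ∂P =
      semigroup s.toNNReal (fun y => |g y|) x := fun s => hX.integral_comp habs _
  rw [hsq, integral_integral_eq_two_mul_of_symm hKm hKb
    (fun s r => by simp only [K, mul_comm]), intervalIntegral.integral_of_le T.coe_nonneg,
    show 4 * M = 2 * (2 * M) by ring, mul_assoc]
  gcongr
  rw [← integral_const_mul]
  refine (le_abs_self _).trans (norm_integral_le_of_norm_le (f := fun s => ∫ r in s..T, K s r)
    (((intervalIntegrable_semigroup habs x 0 T).1).const_mul _) ?_)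
  filter_upwards [ae_restrict_mem measurableSet_Ioc] with s hs
  rw [← hE]
  exact hX.abs_integral_correlation_le hLh hh hs.1.le hs.2

end IsWalk

/-! ### Local times at `0` and `-1` -/

lemma abs_localTime_le {Ω : Type*} (X : ℝ≥0 → Ω → ℤ) (y : ℤ) (T : ℝ≥0) (ω : Ω) :
    |localTime X y T ω| ≤ T := by
  have h := intervalIntegral.norm_integral_le_of_norm_le_const (a := 0) (b := (T : ℝ))
    (f := fun s => Set.indicator {y} (fun _ => (1 : ℝ)) (X s.toNNReal ω)) (C := 1)
    fun s _ => abs_indicator_singleton_le y _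
  rwa [sub_zero, one_mul, abs_of_nonneg T.coe_nonneg] at h

namespace IsWalk

variable {X : ℝ≥0 → Ω → ℤ} {P : Measure Ω} {x : ℤ}

lemma measurable_localTime (hX : IsWalk X P x) (y : ℤ) (T : ℝ≥0) :
    Measurable (localTime X y T) := by
  have h := (((hX.measurable_comp_uncurry (Set.indicator {y} fun _ => (1 : ℝ))).comp
    measurable_swap).stronglyMeasurable.integral_prod_right'
      (ν := volume.restrict (Set.Ioc 0 (T : ℝ)))).measurable
  refine (congrArg Measurable (funext fun ω => ?_)).mp h
  rw [localTime, intervalIntegral.integral_of_le T.coe_nonneg]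
  rfl

lemma localTime_sub_localTime (hX : IsWalk X P x) (T : ℝ≥0) (ω : Ω) :
    localTime X 0 T ω - localTime X (-1) T ω =
      ∫ s in (0 : ℝ)..T, generator (fun z => if 0 ≤ z then -2 else 0) (X s.toNNReal ω) := by
  have hint : ∀ y : ℤ, IntervalIntegrable
      (fun s : ℝ => Set.indicator {y} (fun _ => (1 : ℝ)) (X s.toNNReal ω)) volume 0 T := fun y => by
    have hm : Measurable fun s : ℝ => Set.indicator {y} (fun _ => (1 : ℝ)) (X s.toNNReal ω) :=
      (hX.measurable_comp_uncurry (Set.indicator {y} fun _ => (1 : ℝ))).comp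
        measurable_prodMk_right
    exact intervalIntegrable_const (c := (1 : ℝ)).mono_fun hm.aestronglyMeasurable
      (ae_of_all _ fun s => by simpa using abs_indicator_singleton_le y _)
  simp only [generator_step]
  rw [intervalIntegral.integral_sub (hint 0) (hint (-1))]
  rfl

/-- The second moment of the difference of the local times at `0` and `-1`. -/
lemma integral_sq_localTime_sub_le (hX : IsWalk X P x) (T : ℝ≥0) {δ : ℝ} (hδ : 0 < δ)
    (hδ' : δ ≤ 1) :
    ∫ ω, (localTime X 0 T ω - localTime X (-1) T ω) ^ 2 ∂P ≤ 16 * (2 / δ + T * δ / 2) := by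
  have hh : ∀ y : ℤ, |(fun z : ℤ => if 0 ≤ z then (-2 : ℝ) else 0) y| ≤ 2 := fun y => by
    by_cases h : 0 ≤ y <;> simp [h]
  -- The two indicators have disjoint supports. With `M = 2` the factor `4 * M = 8`, applied to two
  -- Green functions, gives `16`.
  have habs : (fun z : ℤ => |generator (fun z => if 0 ≤ z then -2 else 0) z|) = fun z =>
      Set.indicator {0} (fun _ => (1 : ℝ)) z + Set.indicator {-1} (fun _ => (1 : ℝ)) z := by
    ext z
    rw [generator_step]
    by_cases h : z = 0
    · simp [h]
    · by_cases h' : z = -1 <;> simp [h, h']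
  simp only [hX.localTime_sub_localTime]
  refine (hX.integral_sq_additiveFunctional_le hh T).trans ?_
  simp only [habs, semigroup_add (abs_indicator_singleton_le 0) (abs_indicator_singleton_le (-1))]
  rw [intervalIntegral.integral_add
    (intervalIntegrable_semigroup (abs_indicator_singleton_le 0) x _ _)
    (intervalIntegrable_semigroup (abs_indicator_singleton_le (-1)) x _ _)]
  have h0 := integral_semigroup_indicator_le x 0 T hδ hδ'
  have h1 := integral_semigroup_indicator_le x (-1) T hδ hδ'
  linarith

end IsWalk

end SimpleRandomWalk

end

theorem proposition4p5 (t : ℝ≥0) :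
    ∃ C : ℝ, 0 < C ∧
      ∀ (Ω : Type*) [MeasurableSpace Ω] (P : Measure Ω) (X : ℝ≥0 → Ω → ℤ) (x : ℤ) (n : ℕ),
        1 ≤ n → SimpleRandomWalk.IsWalk X P x →
        (Integrable (fun ω => (SimpleRandomWalk.localTime X 0 (t * (n : ℝ≥0) ^ 2) ω / n -
            SimpleRandomWalk.localTime X (-1) (t * (n : ℝ≥0) ^ 2) ω / n) ^ 2) P ∧
          ∫ ω, (SimpleRandomWalk.localTime X 0 (t * (n : ℝ≥0) ^ 2) ω / n -
            SimpleRandomWalk.localTime X (-1) (t * (n : ℝ≥0) ^ 2) ω / n) ^ 2 ∂P ≤ C * (1 / n)) ∧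
        (Integrable (fun ω => |SimpleRandomWalk.localTime X 0 (t * (n : ℝ≥0) ^ 2) ω / n -
            SimpleRandomWalk.localTime X (-1) (t * (n : ℝ≥0) ^ 2) ω / n|) P ∧
          ∫ ω, |SimpleRandomWalk.localTime X 0 (t * (n : ℝ≥0) ^ 2) ω / n -
            SimpleRandomWalk.localTime X (-1) (t * (n : ℝ≥0) ^ 2) ω / n| ∂P ≤
              C * (1 / Real.sqrt n)) := by

  -- The second moment gives `32 + 8 * t`, which is `16 * (2 / δ + T * δ / 2) / n` at `δ = 1 / n`,
  -- `T = t * n ^ 2`. The extra `1` absorbs the constant term in the first-moment bound.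
  refine ⟨33 + 8 * t, by positivity, fun Ω _ P X x n hn hX => ?_⟩
  have := hX.isProbabilityMeasure
  have hn1 : (1 : ℝ) ≤ n := by exact_mod_cast hn
  have hn0 : (0 : ℝ) < n := by linarith
  set T : ℝ≥0 := t * (n : ℝ≥0) ^ 2 with hT
  set D : Ω → ℝ := fun ω => SimpleRandomWalk.localTime X 0 T ω / n -
    SimpleRandomWalk.localTime X (-1) T ω / n with hD
  have hDm : Measurable D :=
    ((hX.measurable_localTime 0 T).div_const _).sub ((hX.measurable_localTime (-1) T).div_const _)
  have hDb : ∀ ω, |D ω| ≤ 2 * T / n := fun ω => by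
    have h0 := abs_le.1 (SimpleRandomWalk.abs_localTime_le X 0 T ω)
    have h1 := abs_le.1 (SimpleRandomWalk.abs_localTime_le X (-1) T ω)
    simp only [hD]
    rw [← sub_div, abs_div, abs_of_pos hn0]
    gcongr
    rw [abs_le]
    constructor <;> linarith [h0.1, h0.2, h1.1, h1.2]
  have hsq : Integrable (fun ω => D ω ^ 2) P :=
    Integrable.of_bound (hDm.pow_const 2).aestronglyMeasurable ((2 * T / n) ^ 2)
      (ae_of_all _ fun ω => by
        rw [norm_pow]
        exact pow_le_pow_left₀ (norm_nonneg _) (hDb ω) 2)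
  have habs : Integrable (fun ω => |D ω|) P :=
    Integrable.of_bound hDm.abs.aestronglyMeasurable (2 * T / n)
      (ae_of_all _ fun ω => by simpa using hDb ω)
  have hTn : (T : ℝ) = t * (n : ℝ) ^ 2 := by simp [hT]
  have hmom : ∫ ω, D ω ^ 2 ∂P ≤ (32 + 8 * t) * (1 / n) := by
    have h := hX.integral_sq_localTime_sub_le T (δ := 1 / n) (by positivity)
      ((div_le_one hn0).2 hn1)
    have hD2 : ∀ ω, D ω ^ 2 = (1 / n) ^ 2 * (SimpleRandomWalk.localTime X 0 T ω -
        SimpleRandomWalk.localTime X (-1) T ω) ^ 2 := fun ω => by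
      simp only [hD]
      ring
    simp only [hD2]
    rw [integral_const_mul]
    refine (mul_le_mul_of_nonneg_left h (by positivity)).trans_eq ?_
    rw [hTn]
    field_simp
    ring
  have hs : 0 < Real.sqrt n := Real.sqrt_pos.2 hn0
  have hss : Real.sqrt n * Real.sqrt n = n := Real.mul_self_sqrt hn0.le
  refine ⟨⟨hsq, hmom.trans (by gcongr; norm_num)⟩, habs, ?_⟩
  -- The weight `√n` balances the two terms, since `E[D²]` is of order at most `1/n`.
  have hpt : ∀ ω, |D ω| ≤ Real.sqrt n / 2 * D ω ^ 2 + 1 / Real.sqrt n / 2 := fun ω => by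
    have h : Real.sqrt n / 2 * D ω ^ 2 + 1 / Real.sqrt n / 2 - |D ω| =
        (Real.sqrt n * |D ω| - 1) ^ 2 / (2 * Real.sqrt n) := by
      rw [← sq_abs (D ω)]
      field_simp
      ring
    have h' : 0 ≤ (Real.sqrt n * |D ω| - 1) ^ 2 / (2 * Real.sqrt n) := by positivity
    linarith
  calc ∫ ω, |D ω| ∂P
      ≤ ∫ ω, (Real.sqrt n / 2 * D ω ^ 2 + 1 / Real.sqrt n / 2) ∂P :=
        integral_mono habs ((hsq.const_mul _).add (integrable_const _)) hpt
    _ = Real.sqrt n / 2 * ∫ ω, D ω ^ 2 ∂P + 1 / Real.sqrt n / 2 := by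
        rw [integral_add (hsq.const_mul _) (integrable_const _), integral_const_mul]
        simp
    _ ≤ Real.sqrt n / 2 * ((32 + 8 * t) * (1 / n)) + 1 / Real.sqrt n / 2 := by gcongr
    _ = (33 + 8 * t) / 2 * (1 / Real.sqrt n) := by
        nth_rewrite 2 [← hss]
        field_simp
        ring
    _ ≤ (33 + 8 * t) * (1 / Real.sqrt n) := by
        gcongr
        exact half_le_self (by positivity)
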